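/- **Setting.** A tensor network is a finite hypergraph $G=(V,E)$; each hyperedge $e$ has a dimension size $s(e)\in\mathbb{Z}_{\ge1}$ and weight $w(e)=\log s(e)$. It is adjacent to a nonempty set of vertices and may in addition have a dangling end ("uncontracted"); a hyperedge without a dangling end is adjacent to at least two vertices. For an edge set $F\subseteq E$ and disjoint $A,B\subseteq V$, $\mathrm{cut}_F(A,B)$ is the total weight of the hyperedges of $F$ adjacent to both $A$ and $B$; $\mathrm{cut}_F(A)$ is the total weight of the hyperedges of $F$ adjacent to both $A$ and $V\setminus A$, or uncontracted and adjacent to vertices of $A$ only. A contraction tree of $W\subseteq V$ is a rooted binary tree whose leaves are labelled bijectively by $W$; each inner node is a contraction $(A,B)$ of the vertex sets below its two children. The cost of a contraction tree $T_B$ of $V$ is $\mathrm{cost}(T_B)=\sum_{(A,B)}\exp(\mathrm{cut}_E(A)+\mathrm{cut}_E(B)-\mathrm{cut}_E(A,B))$, the sum being over its contractions (classical dense matrix multiplication). A data network is joined to an embedding: $V=V_D\sqcup V_E$, and $E_E\subseteq E$ is the edge set of the embedding, which is a graph. Each $e\in E_E$ is an output edge (uncontracted, at one vertex of $V_E$),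 or joins two vertices of $V_E$, or is an edge to be sketched, joining a vertex of $V_D$ to one of $V_E$. All hyperedges in $E\setminus E_E$ are adjacent to vertices of $V_D$ only. Put $N_E=|V_E|$, and let $m$ be the output sketch size (the product of the sizes of the output edges). Order the vertices with $V_D$ before $V_E$, and direct each contracted edge of $E_E$ to its later end and each output edge outward. The effective sketch dimension of $v\in V_E$ is the product of the sizes of the edges directed out of $v$. For $c>0$, $\varepsilon>0$, $0<\delta<1$, the embedding satisfies the $(\varepsilon,\delta)$-accurate sufficient condition with constant $c$ if for some such order every $v\in V_E$ has effective sketch dimension at least $c\,N_E\log(1/\delta)/\varepsilon^2$. The data has uniform sketch dimensions if every vertex of $V_D$ is adjacent to an edge to be sketched and every edge to be sketched has size greater than $m$. A contraction tree $T_B$ of $V$ is constrained on a contraction tree $T_0$ of $V_D$ if for each contraction $(A,B)$ of $T_0$ there is a contraction $(\hat A,\hat B)$ of $T_B$ with $\hat A\cap V_D=A$ and $\hat B\cap V_D=B$ (the two inputs of a contraction are unordered). Let $(U_1,V_1),\dots,(U_{|V_D|-1},V_{|V_D|-1})$ be the contractions of $T_0$. With $R=E\setminus E_E$, put $$a_i=e^{\mathrm{cut}_R(U_i)-\mathrm{cut}_R(U_i,V_i)},\quad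 c_i=e^{\mathrm{cut}_R(V_i)-\mathrm{cut}_R(U_i,V_i)},\quad d_i=\frac{e^{\mathrm{cut}_R(U_i\cup V_i)}}{a_ic_i},\quad b_i=\frac{e^{\mathrm{cut}_R(U_i,V_i)}}{d_i},$$ $$y_i=a_ib_ic_id_i\,m^2+m^2d_i\sqrt{a_ib_ic_i\,m}\cdot\min(\sqrt{a_i},\sqrt{c_i}).$$ **Theorem.** For all $c,C>0$ there is $\kappa>0$, depending only on $c$ and $C$, such that the following holds. Let $\varepsilon>0$ and $0<\delta<1$. Let the data have uniform sketch dimensions, and let the embedding satisfy the $(\varepsilon,\delta)$-accurate sufficient condition with constant $c$ and have exactly one output edge, of size $m\le C\,N_E\log(1/\delta)/\varepsilon^2$. Let $T_0$ be a contraction tree of $V_D$, and $T_B$ a contraction tree of $V=V_D\sqcup V_E$ constrained on $T_0$. Then $m\ge c\,N_E\log(1/\delta)/\varepsilon^2$ and $$\mathrm{cost}(T_B)\ \ge\ \kappa\Big(\sum_{v\in V_D}\exp(\mathrm{cut}_E(\{v\}))\,m+\sum_{i=1}^{|V_D|-1}y_i\Big),$$ where $\exp(\mathrm{cut}_E(\{v\}))$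 is the size of the tensor at $v$. -/

import Mathlib

universe u v

/-- A tensor diagram: a finite hypergraph whose hyperedges `e` carry a dimension size `dim e ≥ 1`.
`ends e` is the set of vertices adjacent to `e`; the hyperedges in `uncontracted` have in addition a
dangling end. A hyperedge without a dangling end joins at least two vertices. -/
structure TensorNetwork (V : Type u) (E : Type v) where
  ends : E → Finset V
  uncontracted : Finset E
  dim : E → ℕ
  ends_nonempty : ∀ e, (ends e).Nonempty
  two_le_card_ends : ∀ e, e ∉ uncontracted → 2 ≤ (ends e).card
  dim_pos : ∀ e, 0 < dim e

namespace TensorNetwork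

variable {V : Type u} {E : Type v} [Fintype V] [DecidableEq V] [DecidableEq E]

/-- The weight of a hyperedge: the natural logarithm of its dimension size. -/
noncomputable def weight (G : TensorNetwork V E) (e : E) : ℝ := Real.log (G.dim e)

/-- `E(A, B)`: the hyperedges of the edge set `F` adjacent to both `A` and `B`. -/
def edgesBetween (G : TensorNetwork V E) (F : Finset E) (A B : Finset V) : Finset E :=
  F.filter fun e => (G.ends e ∩ A).Nonempty ∧ (G.ends e ∩ B).Nonempty

/-- `E(A, *)`: the uncontracted hyperedges of `F` adjacent to vertices of `A` only. -/
def openEdges (G : TensorNetwork V E) (F : Finset E) (A : Finset V) : Finset E :=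
  F.filter fun e => e ∈ G.uncontracted ∧ G.ends e ⊆ A

/-- `E(A) = E(A, V \ A) ∪ E(A, *)`, within the edge set `F`. -/
def boundary (G : TensorNetwork V E) (F : Finset E) (A : Finset V) : Finset E :=
  G.edgesBetween F A Aᶜ ∪ G.openEdges F A

/-- `cut(A, B)` in the hypergraph with edge set `F`. -/
noncomputable def cutBetween (G : TensorNetwork V E) (F : Finset E) (A B : Finset V) : ℝ :=
  ∑ e ∈ G.edgesBetween F A B, G.weight e

/-- `cut(A)` in the hypergraph with edge set `F`: the logarithm of the size of the tensor obtained
by contracting the vertices of `A`. -/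
noncomputable def cut (G : TensorNetwork V E) (F : Finset E) (A : Finset V) : ℝ :=
  ∑ e ∈ G.boundary F A, G.weight e

/-- The logarithm of the cost of contracting (by classical dense matrix multiplication) the tensors
represented by the disjoint vertex sets `A` and `B`. -/
noncomputable def logCost (G : TensorNetwork V E) (F : Finset E) (A B : Finset V) : ℝ :=
  G.cut F A + G.cut F B - G.cutBetween F A B

end TensorNetwork

/-- Rooted binary trees with leaves labelled by vertices. -/
inductive ContractionTree (V : Type u) where
  | leaf (x : V) : ContractionTree V
  | node (l r : ContractionTree V) : ContractionTree V

namespace ContractionTree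

variable {V : Type u} [DecidableEq V]

def leaves : ContractionTree V → List V
  | leaf x => [x]
  | node l r => l.leaves ++ r.leaves

/-- The vertex set whose contraction output is represented by the root of the tree. -/
def verts (T : ContractionTree V) : Finset V := T.leaves.toFinset

/-- `T` is a contraction tree of a tensor network with vertex set `W`: every vertex of `W` labels
exactly one leaf. -/
def IsTreeOf (T : ContractionTree V) (W : Finset V) : Prop :=
  T.leaves.Nodup ∧ T.verts = W

/-- The contractions `(A, B)` performed by the tree, one for each inner node, listed in a
topological order. -/
def contractions : ContractionTree V → List (Finset V × Finset V)
  | leaf _ => []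
  | node l r => l.contractions ++ r.contractions ++ [(l.verts, r.verts)]

/-- The tensors represented by `A` and `B` are contracted with each other in `T`; the two children
of a node are not ordered. -/
def Contracts (T : ContractionTree V) (A B : Finset V) : Prop :=
  (A, B) ∈ T.contractions ∨ (B, A) ∈ T.contractions

/-- `T` is constrained on the contraction tree `T₀` of the network with vertex set `W`. -/
def ConstrainedOn (T T₀ : ContractionTree V) (W : Finset V) : Prop :=
  ∀ A B : Finset V, T₀.Contracts A B →
    ∃ A' B' : Finset V, T.Contracts A' B' ∧ A' ∩ W = A ∧ B' ∩ W = B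

/-- The cost of contracting the tensor network `G` along the tree `T`. -/
noncomputable def cost {E : Type v} [Fintype V] [Fintype E] [DecidableEq E]
    (T : ContractionTree V) (G : TensorNetwork V E) : ℝ :=
  (T.contractions.map fun p => Real.exp (G.logCost Finset.univ p.1 p.2)).sum

end ContractionTree

/-- The overall tensor network `G = (G_D, G_E)` of a data tensor network and an embedding applied to
it. The vertex set is the disjoint union of the embedding vertices `embV` and the data vertices
`embVᶜ`; `embE` is the edge set of the embedding, including the edges joining it to the data.
The edges outside `embE` form an arbitrary hypergraph on the data vertices. The embedding is a graph:
each of its edges is either an output edge (uncontracted, at one embedding vertex), or an edge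
between two embedding vertices, or an edge to be sketched, joining a data vertex to an
embedding vertex. -/
structure SketchedNetwork (V : Type u) (E : Type v) [Fintype V] [DecidableEq V]
    extends TensorNetwork V E where
  embV : Finset V
  embE : Finset E
  ends_subset_data : ∀ e, e ∉ embE → ends e ⊆ embVᶜ
  ends_inter_embV : ∀ e ∈ embE, (ends e ∩ embV).Nonempty
  card_ends_output : ∀ e ∈ embE, e ∈ uncontracted → (ends e).card = 1
  card_ends_contracted : ∀ e ∈ embE, e ∉ uncontracted → (ends e).card = 2

namespace SketchedNetwork

variable {V : Type u} {E : Type v} [Fintype V] [DecidableEq V] [Fintype E] [DecidableEq E]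

/-- The data vertices `V_D`. -/
def dataV (G : SketchedNetwork V E) : Finset V := G.embVᶜ

/-- The set of edges to be sketched: the edges joining the data to the embedding. -/
def sketchEdges (G : SketchedNetwork V E) : Finset E :=
  G.embE.filter fun e => (G.ends e ∩ G.dataV).Nonempty

/-- The output sketch dimensions: the uncontracted edges of the embedding. -/
def outputEdges (G : SketchedNetwork V E) : Finset E :=
  G.embE.filter fun e => e ∈ G.uncontracted

/-- The output sketch size `m`. -/
def sketchSize (G : SketchedNetwork V E) : ℕ := ∏ e ∈ G.outputEdges, G.dim e

/-- The edges of `R`: the data edges that are not to be sketched. -/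
def dataOnlyEdges (G : SketchedNetwork V E) : Finset E := G.embEᶜ

/-- Vertex orderings defining the sketching linearizations: the data vertices come before the
embedding vertices. -/
def IsSketchOrder (G : SketchedNetwork V E) (pos : V → ℕ) : Prop :=
  Function.Injective pos ∧ ∀ x ∈ G.dataV, ∀ y ∈ G.embV, pos x < pos y

/-- The embedding edges directed out of `x` in the linearization given by `pos`: contracted edges are
directed towards the later end, uncontracted edges away from their vertex. -/
def outEdges (G : SketchedNetwork V E) (pos : V → ℕ) (x : V) : Finset E :=
  G.embE.filter fun e =>
    x ∈ G.ends e ∧ (e ∈ G.uncontracted ∨ ∃ y ∈ G.ends e, pos x < pos y)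

/-- The effective sketch dimension of an embedding vertex: the row size of its matricization in the
linearization given by `pos`. -/
def effSketchDim (G : SketchedNetwork V E) (pos : V → ℕ) (x : V) : ℕ :=
  ∏ e ∈ G.outEdges pos x, G.dim e

/-- The quantity `N_E log(1/δ) / ε²`. -/
noncomputable def accuracyScale (G : SketchedNetwork V E) (ε δ : ℝ) : ℝ :=
  (G.embV.card : ℝ) * Real.log (1 / δ) / ε ^ 2

/-- The `(ε, δ)`-accurate sufficient condition, with implied constant `c`: in some linearization,
every embedding tensor has row size at least `c N_E log(1/δ) / ε²`. -/
def SufficientCondition (G : SketchedNetwork V E) (c ε δ : ℝ) : Prop :=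
  ∃ pos : V → ℕ, G.IsSketchOrder pos ∧
    ∀ x ∈ G.embV, c * G.accuracyScale ε δ ≤ (G.effSketchDim pos x : ℝ)

/-- Uniform sketch dimensions: every data vertex is adjacent to an edge to be sketched, and all edges
to be sketched have size greater than the sketch size. -/
def UniformSketchDims (G : SketchedNetwork V E) : Prop :=
  (∀ x ∈ G.dataV, ∃ e ∈ G.sketchEdges, x ∈ G.ends e) ∧
    ∀ e ∈ G.sketchEdges, G.sketchSize < G.dim e

/-- `a` for the contraction `(A, B)` (and `c`, when used for `(B, A)`). -/
noncomputable def sizeLeft (G : SketchedNetwork V E) (A B : Finset V) : ℝ :=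
  Real.exp (G.cut G.dataOnlyEdges A - G.cutBetween G.dataOnlyEdges A B)

/-- `d`: the size of the remaining dimensions adjacent to both `A` and `B`. -/
noncomputable def sizeShared (G : SketchedNetwork V E) (A B : Finset V) : ℝ :=
  Real.exp (G.cut G.dataOnlyEdges (A ∪ B)) / (G.sizeLeft A B * G.sizeLeft B A)

/-- `b`: the size of the dimensions contracted between `A` and `B`. -/
noncomputable def sizeContracted (G : SketchedNetwork V E) (A B : Finset V) : ℝ :=
  Real.exp (G.cutBetween G.dataOnlyEdges A B) / G.sizeShared A B

/-- `y = a b c d m² + m² d √(a b c m) · min(√a, √c)` for the contraction `(A, B)`. -/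
noncomputable def sketchTerm (G : SketchedNetwork V E) (A B : Finset V) : ℝ :=
  let a := G.sizeLeft A B
  let b := G.sizeContracted A B
  let c := G.sizeLeft B A
  let d := G.sizeShared A B
  let m := (G.sketchSize : ℝ)
  a * b * c * d * m ^ 2
    + m ^ 2 * d * Real.sqrt (a * b * c * m) * min (Real.sqrt a) (Real.sqrt c)

end SketchedNetwork

/-!
Cutting the vertex sets of `T` down to the data turns its contractions into nodes of `T₀`, and every
contraction of `T` is charged to its two inputs and its output, so the costs charged to all nodes
of `T₀` add up to at most three times the cost of `T`.

Let `t = c N_E log(1/δ) / ε²`, so that `t ≤ m ≤ (C / c) t`. In the linearization, the edges leaving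
a nonempty set `A` of vertices have total size at least `t`: the last embedding vertex of `A` sends
all its outgoing edges out of `A`, and if there is none, a sketched edge of size more than `m`
leaves `A`. Edges leaving disjoint sets are distinct, so contracting `A` with `B` costs at least
`exp (cut_R(A) + cut_R(B) - cut_R(A, B)) t²`, which pays for `a b c d m²`.

For the second summand, let the last embedding vertex of `A ∪ B` be in `A`. Its outgoing edges
leave `A ∪ B`, and the edges leaving `B` either leave `A ∪ B` or end in `A`; hence `t² ≤ f q`, where
`f` is the size of the edges leaving `A ∪ B` and `q` that of the edges from `B` to `A`. Up to
constants, consuming the output `A ∪ B` costs at least `a c d f m`, and forming `A` costs at least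
`a b d q m²`. The geometric mean of these two costs is at least `m² d √(a b c m) √a`.
-/

namespace ContractionTree

variable {V : Type u} [DecidableEq V]

/-- The tensors formed in the course of the contraction, one for each node of the tree, as the
vertex sets they represent. -/
def nodes : ContractionTree V → List (Finset V)
  | leaf x => [{x}]
  | node l r => l.nodes ++ r.nodes ++ [l.verts ∪ r.verts]

lemma verts_leaf (x : V) : (leaf x).verts = {x} := by
  simp [verts, leaves]

lemma verts_node (l r : ContractionTree V) : (node l r).verts = l.verts ∪ r.verts := by
  simp [verts, leaves]

lemma nodup_leaves_node {l r : ContractionTree V} :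
    (node l r).leaves.Nodup ↔ l.leaves.Nodup ∧ r.leaves.Nodup ∧ Disjoint l.verts r.verts := by
  simp only [leaves, List.nodup_append', verts, List.disjoint_toFinset_iff_disjoint]

lemma mem_nodes_node {l r : ContractionTree V} {S : Finset V} :
    S ∈ (node l r).nodes ↔ S ∈ l.nodes ∨ S ∈ r.nodes ∨ S = l.verts ∪ r.verts := by
  simp [nodes]

lemma contracts_node {l r : ContractionTree V} {A B : Finset V} :
    (node l r).Contracts A B ↔ l.Contracts A B ∨ r.Contracts A B ∨
      (A = l.verts ∧ B = r.verts) ∨ (B = l.verts ∧ A = r.verts) := by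
  simp only [Contracts, contractions, List.mem_append, List.mem_singleton, Prod.mk.injEq]
  tauto

lemma not_contracts_leaf (x : V) (A B : Finset V) : ¬(leaf x).Contracts A B := by
  simp [Contracts, contractions]

variable {T : ContractionTree V} {A B S : Finset V}

lemma verts_mem_nodes (T : ContractionTree V) : T.verts ∈ T.nodes := by
  cases T <;> simp [nodes, verts_leaf, verts_node]

lemma nonempty_of_mem_nodes (hS : S ∈ T.nodes) : S.Nonempty := by
  induction T generalizing S with
  | leaf x => simp_all [nodes]
  | node l r hl hr =>
    rcases mem_nodes_node.1 hS with h | h | rfl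
    · exact hl h
    · exact hr h
    · exact (hl l.verts_mem_nodes).mono Finset.subset_union_left

lemma subset_verts_of_mem_nodes (hS : S ∈ T.nodes) : S ⊆ T.verts := by
  induction T with
  | leaf x => simp_all [nodes, verts_leaf]
  | node l r hl hr =>
    rw [verts_node]
    rcases mem_nodes_node.1 hS with h | h | rfl
    · exact (hl h).trans Finset.subset_union_left
    · exact (hr h).trans Finset.subset_union_right
    · exact subset_rfl

lemma verts_nonempty (T : ContractionTree V) : T.verts.Nonempty :=
  nonempty_of_mem_nodes T.verts_mem_nodes

lemma singleton_mem_nodes {x : V} (hx : x ∈ T.verts) : {x} ∈ T.nodes := by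
  induction T with
  | leaf y => simp_all [nodes, verts_leaf]
  | node l r hl hr =>
    rw [verts_node, Finset.mem_union] at hx
    exact mem_nodes_node.2 (hx.imp hl fun h => Or.inl (hr h))

lemma nodup_nodes (hT : T.leaves.Nodup) : T.nodes.Nodup := by
  induction T with
  | leaf x => simp [nodes]
  | node l r hl hr =>
    obtain ⟨hl', hr', hlr⟩ := nodup_leaves_node.1 hT
    have separate : List.Disjoint l.nodes r.nodes := fun S hSl hSr =>
      (nonempty_of_mem_nodes hSl).ne_empty <| Finset.disjoint_self_iff_empty S |>.1 <|
        hlr.mono (subset_verts_of_mem_nodes hSl) (subset_verts_of_mem_nodes hSr)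
    have root_notMem_left : l.verts ∪ r.verts ∉ l.nodes := fun h =>
      r.verts_nonempty.ne_empty <| hlr.symm.eq_bot_of_le <|
        Finset.subset_union_right.trans (subset_verts_of_mem_nodes h)
    have root_notMem_right : l.verts ∪ r.verts ∉ r.nodes := fun h =>
      l.verts_nonempty.ne_empty <| hlr.eq_bot_of_le <|
        Finset.subset_union_left.trans (subset_verts_of_mem_nodes h)
    simp only [nodes, List.nodup_append', List.nodup_singleton, List.disjoint_singleton,
      List.mem_append, not_or]
    exact ⟨⟨hl hl', hr hr', separate⟩, trivial, root_notMem_left, root_notMem_right⟩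

lemma sum_map_nodes_eq_leaves_add_outputs {M : Type*} [AddCommMonoid M] (f : Finset V → M)
    (T : ContractionTree V) :
    (T.nodes.map f).sum =
      (T.leaves.map fun x => f {x}).sum + (T.contractions.map fun p => f (p.1 ∪ p.2)).sum := by
  induction T with
  | leaf x => simp [nodes, leaves, contractions]
  | node l r hl hr =>
    simp only [nodes, leaves, contractions, List.map_append, List.sum_append, hl, hr,
      List.map_singleton, List.sum_singleton]
    abel

lemma sum_map_nodes_eq_inputs_add_root {M : Type*} [AddCommMonoid M] (f : Finset V → M)
    (T : ContractionTree V) :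
    (T.nodes.map f).sum = (T.contractions.map fun p => f p.1 + f p.2).sum + f T.verts := by
  induction T with
  | leaf x => simp [nodes, contractions, verts_leaf]
  | node l r hl hr =>
    simp only [nodes, contractions, verts_node, List.map_append, List.sum_append, hl, hr,
      List.map_singleton, List.sum_singleton]
    abel

lemma sum_leaves_add_sum_contractions_le {f : Finset V → ℝ} (hf : ∀ S, 0 ≤ f S)
    (T : ContractionTree V) :
    (T.leaves.map fun x => f {x}).sum +
        (T.contractions.map fun p => 3 * f (p.1 ∪ p.2) + (f p.1 + f p.2)).sum ≤
      4 * (T.nodes.map f).sum := by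
  have hleaves : 0 ≤ (T.leaves.map fun x => f {x}).sum :=
    List.sum_nonneg (List.forall_mem_map.2 fun x _ => hf {x})
  rw [List.sum_map_add, List.sum_map_mul_left]
  linarith [sum_map_nodes_eq_leaves_add_outputs f T, sum_map_nodes_eq_inputs_add_root f T,
    hf T.verts]

namespace Contracts

lemma symm (h : T.Contracts A B) : T.Contracts B A := Or.symm h

lemma left_mem_nodes (h : T.Contracts A B) : A ∈ T.nodes := by
  induction T with
  | leaf x => exact (not_contracts_leaf x A B h).elim
  | node l r hl hr =>
    rw [mem_nodes_node]
    rcases contracts_node.1 h with h | h | ⟨rfl, -⟩ | ⟨-, rfl⟩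
    · exact Or.inl (hl h)
    · exact Or.inr (Or.inl (hr h))
    · exact Or.inl l.verts_mem_nodes
    · exact Or.inr (Or.inl r.verts_mem_nodes)

lemma union_mem_nodes (h : T.Contracts A B) : A ∪ B ∈ T.nodes := by
  induction T with
  | leaf x => exact (not_contracts_leaf x A B h).elim
  | node l r hl hr =>
    rw [mem_nodes_node]
    rcases contracts_node.1 h with h | h | ⟨rfl, rfl⟩ | ⟨rfl, rfl⟩
    · exact Or.inl (hl h)
    · exact Or.inr (Or.inl (hr h))
    · exact Or.inr (Or.inr rfl)
    · exact Or.inr (Or.inr (Finset.union_comm _ _))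

lemma left_nonempty (h : T.Contracts A B) : A.Nonempty := nonempty_of_mem_nodes h.left_mem_nodes

lemma right_nonempty (h : T.Contracts A B) : B.Nonempty := h.symm.left_nonempty

lemma disjoint (h : T.Contracts A B) (hT : T.leaves.Nodup) : Disjoint A B := by
  induction T with
  | leaf x => exact (not_contracts_leaf x A B h).elim
  | node l r hl hr =>
    obtain ⟨hl', hr', hlr⟩ := nodup_leaves_node.1 hT
    rcases contracts_node.1 h with h | h | ⟨rfl, rfl⟩ | ⟨rfl, rfl⟩
    · exact hl h hl'
    · exact hr h hr'
    · exact hlr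
    · exact hlr.symm

end Contracts

lemma exists_contracts_of_mem_nodes (hS : S ∈ T.nodes) (hne : S ≠ T.verts) :
    ∃ B, T.Contracts S B := by
  induction T with
  | leaf x => simp_all [nodes, verts_leaf]
  | node l r hl hr =>
    simp only [contracts_node]
    rcases mem_nodes_node.1 hS with h | h | h
    · by_cases hroot : S = l.verts
      · exact ⟨r.verts, by simp [hroot]⟩
      · exact (hl h hroot).imp fun _ => Or.inl
    · by_cases hroot : S = r.verts
      · exact ⟨l.verts, by simp [hroot]⟩
      · exact (hr h hroot).imp fun _ hB => Or.inr (Or.inl hB)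
    · exact absurd (h.trans (verts_node l r).symm) hne

lemma eq_singleton_or_eq_union_of_mem_nodes (hS : S ∈ T.nodes) :
    (∃ x, S = {x}) ∨ ∃ X Y, T.Contracts X Y ∧ S = X ∪ Y := by
  induction T with
  | leaf x => exact Or.inl ⟨x, by simpa [nodes] using hS⟩
  | node l r hl hr =>
    simp only [contracts_node]
    rcases mem_nodes_node.1 hS with h | h | h
    · exact (hl h).imp_right fun ⟨X, Y, hXY, e⟩ => ⟨X, Y, Or.inl hXY, e⟩
    · exact (hr h).imp_right fun ⟨X, Y, hXY, e⟩ => ⟨X, Y, Or.inr (Or.inl hXY), e⟩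
    · exact Or.inr ⟨l.verts, r.verts, by simp, h⟩

end ContractionTree

namespace TensorNetwork

section Size

variable {V : Type u} {E : Type v} (G : TensorNetwork V E) {F F' : Finset E}

/-- The size of a tensor whose legs are the hyperedges in `F`: the product of their dimensions. -/
noncomputable def size (G : TensorNetwork V E) (F : Finset E) : ℝ := ∏ e ∈ F, (G.dim e : ℝ)

lemma one_le_dim (e : E) : (1 : ℝ) ≤ G.dim e := by
  exact_mod_cast G.dim_pos e

lemma size_pos (F : Finset E) : 0 < G.size F :=
  Finset.prod_pos fun e _ => zero_lt_one.trans_le (G.one_le_dim e)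

lemma size_mono (h : F ⊆ F') : G.size F ≤ G.size F' :=
  Finset.prod_le_prod_of_subset_of_one_le h
    (fun e _ => zero_le_one.trans (G.one_le_dim e)) fun e _ _ => G.one_le_dim e

lemma dim_le_size {e : E} (h : e ∈ F) : (G.dim e : ℝ) ≤ G.size F := by
  simpa [size] using G.size_mono (Finset.singleton_subset_iff.2 h)

lemma size_union [DecidableEq E] (h : Disjoint F F') : G.size (F ∪ F') = G.size F * G.size F' :=
  Finset.prod_union h

lemma exp_sum_weight (F : Finset E) : Real.exp (∑ e ∈ F, G.weight e) = G.size F := by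
  rw [Real.exp_sum]
  exact Finset.prod_congr rfl fun e _ => Real.exp_log (zero_lt_one.trans_le (G.one_le_dim e))

end Size

variable {V : Type u} {E : Type v} [DecidableEq V] (G : TensorNetwork V E) (F : Finset E)
  {A B : Finset V}

lemma cutBetween_comm (A B : Finset V) : G.cutBetween F A B = G.cutBetween F B A := by
  simp only [cutBetween, edgesBetween, and_comm]

variable [Fintype V] [DecidableEq E]

lemma mem_boundary {F : Finset E} {e : E} :
    e ∈ G.boundary F A ↔ e ∈ F ∧ (∃ x ∈ G.ends e, x ∈ A) ∧
      (e ∈ G.uncontracted ∨ ∃ y ∈ G.ends e, y ∉ A) := by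
  obtain ⟨z, hz⟩ := G.ends_nonempty e
  simp only [boundary, edgesBetween, openEdges, Finset.mem_union, Finset.mem_filter,
    Finset.Nonempty, Finset.mem_inter, Finset.mem_compl, Finset.subset_iff]
  grind

lemma boundary_mono {F F' : Finset E} (h : F ⊆ F') (A : Finset V) :
    G.boundary F A ⊆ G.boundary F' A := fun _ he =>
  G.mem_boundary.2 ((G.mem_boundary.1 he).imp_left (@h _))

lemma boundary_union_subset (A B : Finset V) :
    G.boundary F (A ∪ B) ⊆ G.boundary F A ∪ G.boundary F B := by
  intro e
  simp only [Finset.mem_union, mem_boundary]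
  grind

lemma boundary_inter_boundary (h : Disjoint A B) :
    G.boundary F A ∩ G.boundary F B = G.edgesBetween F A B := by
  ext e
  have := @Finset.disjoint_left _ A B
  simp only [Finset.mem_inter, mem_boundary, edgesBetween, Finset.mem_filter, Finset.Nonempty]
  grind

lemma logCost_comm (A B : Finset V) : G.logCost F A B = G.logCost F B A := by
  rw [logCost, logCost, G.cutBetween_comm F A B, add_comm (G.cut F A)]

lemma exp_cut (A : Finset V) : Real.exp (G.cut F A) = G.size (G.boundary F A) :=
  G.exp_sum_weight _

lemma exp_logCost (h : Disjoint A B) :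
    Real.exp (G.logCost F A B) = G.size (G.boundary F A ∪ G.boundary F B) := by
  rw [← exp_sum_weight, logCost, cut, cut, cutBetween, ← G.boundary_inter_boundary F h,
    ← Finset.sum_union_inter, add_sub_cancel_right]

lemma exp_cut_le_exp_logCost (h : Disjoint A B) :
    Real.exp (G.cut F A) ≤ Real.exp (G.logCost F A B) := by
  rw [exp_cut, G.exp_logCost F h]
  exact G.size_mono Finset.subset_union_left

lemma exp_cut_union_le_exp_logCost (h : Disjoint A B) :
    Real.exp (G.cut F (A ∪ B)) ≤ Real.exp (G.logCost F A B) := by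
  rw [exp_cut, G.exp_logCost F h]
  exact G.size_mono (G.boundary_union_subset F A B)

end TensorNetwork

namespace ContractionTree

variable {V : Type u} {E : Type v} [Fintype V] [DecidableEq V] [Fintype E] [DecidableEq E]
  (T : ContractionTree V) (G : TensorNetwork V E) (W : Finset V)

/-- The total cost of the contractions of `T` at which, after restriction to the vertices in `W`,
the vertex set `S` is an input or the output. It is the part of the cost of `T` charged to the
node `S` of a contraction tree of `W`. -/
noncomputable def costAt (S : Finset V) : ℝ :=
  (T.contractions.map fun p =>
    if S ∈ ({p.1 ∩ W, p.2 ∩ W, (p.1 ∪ p.2) ∩ W} : Finset (Finset V)) then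
      Real.exp (G.logCost Finset.univ p.1 p.2) else 0).sum

lemma costAt_nonneg (S : Finset V) : 0 ≤ T.costAt G W S :=
  List.sum_nonneg <| by
    simp only [List.forall_mem_map]
    intro p _
    positivity

lemma sum_costAt_le (𝒮 : Finset (Finset V)) :
    ∑ S ∈ 𝒮, T.costAt G W S ≤ 3 * T.cost G := by
  simp only [costAt, cost]
  induction T.contractions with
  | nil => simp
  | cons p l ih =>
    simp only [List.map_cons, List.sum_cons, Finset.sum_add_distrib, mul_add]
    refine add_le_add ?_ ih
    rw [Finset.sum_ite_mem, Finset.sum_const, nsmul_eq_mul]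
    gcongr
    exact_mod_cast (Finset.card_le_card Finset.inter_subset_right).trans Finset.card_le_three

variable {T} {A B : Finset V}

lemma le_costAt_of_mem {p : Finset V × Finset V} (hp : p ∈ T.contractions) {S : Finset V}
    (hS : S ∈ ({p.1 ∩ W, p.2 ∩ W, (p.1 ∪ p.2) ∩ W} : Finset (Finset V))) :
    Real.exp (G.logCost Finset.univ p.1 p.2) ≤ T.costAt G W S := by
  refine List.single_le_sum ?_ _ (List.mem_map.2 ⟨p, hp, if_pos hS⟩)
  simp only [List.forall_mem_map]
  intro q _
  positivity

namespace Contracts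

lemma exp_logCost_le_costAt_left (h : T.Contracts A B) :
    Real.exp (G.logCost Finset.univ A B) ≤ T.costAt G W (A ∩ W) := by
  rcases h with h | h
  · exact le_costAt_of_mem G W h (by simp)
  · rw [G.logCost_comm]
    exact le_costAt_of_mem G W h (by simp)

lemma exp_logCost_le_costAt_union (h : T.Contracts A B) :
    Real.exp (G.logCost Finset.univ A B) ≤ T.costAt G W ((A ∪ B) ∩ W) := by
  rcases h with h | h
  · exact le_costAt_of_mem G W h (by simp)
  · rw [G.logCost_comm, Finset.union_comm]
    exact le_costAt_of_mem G W h (by simp)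

end Contracts

end ContractionTree

/-- The inequality behind the second summand of `SketchedNetwork.sketchTerm`: if `t ^ 2` is split
as `f * q`, the square of that summand is at most a multiple of the product of a cost `X` that pays
for `f` and a cost `Y` that pays for `q`. -/
lemma sq_mul_sqrt_mul_sqrt_le {a b c d m t K f q X Y : ℝ} (ha : 0 ≤ a) (hb : 0 ≤ b) (hc : 0 ≤ c)
    (hd : 0 ≤ d) (hm : 0 ≤ m) (hK : 0 ≤ K) (hq : 0 ≤ q) (hX₀ : 0 ≤ X) (hmt : m ≤ K * t)
    (hX : a * c * d * (f * m) ≤ K ^ 2 * X) (hY : a * b * d * (q * t ^ 2) ≤ Y)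
    (hfq : t ^ 2 ≤ f * q) :
    m ^ 2 * d * Real.sqrt (a * b * c * m) * Real.sqrt a ≤ K ^ 3 * (X + Y) := by
  have hY₀ : 0 ≤ Y := le_trans (by positivity) hY
  have hm_sq : m ^ 2 ≤ K ^ 2 * t ^ 2 := mul_pow K t 2 ▸ pow_le_pow_left₀ hm hmt 2
  refine (pow_le_pow_iff_left₀ (by positivity) (by positivity) two_ne_zero).1 ?_
  calc (m ^ 2 * d * Real.sqrt (a * b * c * m) * Real.sqrt a) ^ 2
      = (m ^ 2 * d) ^ 2 * Real.sqrt (a * b * c * m) ^ 2 * Real.sqrt a ^ 2 := by ring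
    _ = (a * c * d * m) * (a * b * d) * (m ^ 2 * m ^ 2) := by
        rw [Real.sq_sqrt (by positivity), Real.sq_sqrt ha]; ring
    _ ≤ (a * c * d * m) * (a * b * d) * ((K ^ 2 * t ^ 2) * (K ^ 2 * (f * q))) := by
        gcongr
        exact hm_sq.trans (by gcongr)
    _ = K ^ 4 * ((a * c * d * (f * m)) * (a * b * d * (q * t ^ 2))) := by ring
    _ ≤ K ^ 4 * ((K ^ 2 * X) * Y) := by gcongr
    _ = (K ^ 3) ^ 2 * (X * Y) := by ring
    _ ≤ (K ^ 3) ^ 2 * (X + Y) ^ 2 := by gcongr; nlinarith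
    _ = (K ^ 3 * (X + Y)) ^ 2 := by ring

namespace SketchedNetwork

section Flow

variable {V : Type u} {E : Type v} [Fintype V] [DecidableEq V] (G : SketchedNetwork V E)
  {e : E} {x y z : V} {A B : Finset V}

lemma mem_dataV : x ∈ G.dataV ↔ x ∉ G.embV := by
  simp [dataV]

lemma exists_mem_ends_embV (he : e ∈ G.embE) : ∃ z ∈ G.ends e, z ∈ G.embV := by
  simpa [Finset.Nonempty] using G.ends_inter_embV e he

lemma notMem_uncontracted (he : e ∈ G.embE) (hx : x ∈ G.ends e) (hy : y ∈ G.ends e)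
    (hxy : x ≠ y) : e ∉ G.uncontracted := fun h =>
  hxy (Finset.card_le_one.1 (G.card_ends_output e he h).le x hx y hy)

lemma eq_or_eq_of_mem_ends (he : e ∈ G.embE) (hx : x ∈ G.ends e) (hy : y ∈ G.ends e)
    (hxy : x ≠ y) (hz : z ∈ G.ends e) : z = x ∨ z = y := by
  have hcard := G.card_ends_contracted e he (G.notMem_uncontracted he hx hy hxy)
  have hends : {x, y} = G.ends e := Finset.eq_of_subset_of_card_le
    (by simp [Finset.insert_subset_iff, hx, hy]) (by rw [hcard, Finset.card_pair hxy])
  simpa [← hends] using hz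

variable [DecidableEq E]

/-- The embedding edges that leave the vertex set `A` in the linearization given by `pos`: the tail
is in `A`, and the edge is an output edge or has its head outside `A`. For `A = {x}` with `x` an
embedding vertex this is `outEdges`. -/
def outFlow (G : SketchedNetwork V E) (pos : V → ℕ) (A : Finset V) : Finset E :=
  G.embE.filter fun e =>
    ∃ x ∈ G.ends e, x ∈ A ∧ (e ∈ G.uncontracted ∨ ∃ y ∈ G.ends e, y ∉ A ∧ pos x < pos y)

variable {pos : V → ℕ}

lemma mem_outFlow :
    e ∈ G.outFlow pos A ↔ e ∈ G.embE ∧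
      ∃ x ∈ G.ends e, x ∈ A ∧ (e ∈ G.uncontracted ∨ ∃ y ∈ G.ends e, y ∉ A ∧ pos x < pos y) := by
  simp [outFlow]

lemma outFlow_subset_embE (pos : V → ℕ) (A : Finset V) : G.outFlow pos A ⊆ G.embE :=
  Finset.filter_subset _ _

lemma outFlow_univ_subset (pos : V → ℕ) : G.outFlow pos Finset.univ ⊆ G.outputEdges := by
  intro e he
  have := G.mem_outFlow.1 he
  simp only [outputEdges, Finset.mem_filter]
  grind

lemma outFlow_disjoint (pos : V → ℕ) (h : Disjoint A B) :
    Disjoint (G.outFlow pos A) (G.outFlow pos B) := by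
  rw [Finset.disjoint_left]
  intro e hA hB
  obtain ⟨he, x, hx, hxA, hA⟩ := G.mem_outFlow.1 hA
  obtain ⟨-, y, hy, hyB, hB⟩ := G.mem_outFlow.1 hB
  have hxy : x ≠ y := fun hxy => Finset.disjoint_left.1 h hxA (hxy ▸ hyB)
  have hu := G.notMem_uncontracted he hx hy hxy
  obtain ⟨z, hz, hzA, hxz⟩ := hA.resolve_left hu
  obtain ⟨w, hw, hwB, hyw⟩ := hB.resolve_left hu
  obtain rfl : z = y := (G.eq_or_eq_of_mem_ends he hx hy hxy hz).resolve_left fun h => hzA (h ▸ hxA)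
  obtain rfl : w = x := (G.eq_or_eq_of_mem_ends he hx hy hxy hw).resolve_right fun h =>
    hwB (h ▸ hyB)
  exact hxz.asymm hyw

lemma outFlow_subset_boundary [Fintype E] (pos : V → ℕ) (A : Finset V) :
    G.outFlow pos A ⊆ G.boundary Finset.univ A := by
  intro e he
  obtain ⟨-, x, hx, hxA, h⟩ := G.mem_outFlow.1 he
  exact G.mem_boundary.2 ⟨Finset.mem_univ e, ⟨x, hx, hxA⟩,
    h.imp_right fun ⟨y, hy, hyA, _⟩ => ⟨y, hy, hyA⟩⟩

lemma outFlow_sdiff_outFlow_union_subset_boundary [Fintype E] (pos : V → ℕ) (h : Disjoint A B) :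
    G.outFlow pos B \ G.outFlow pos (A ∪ B) ⊆ G.boundary Finset.univ A := by
  intro e he
  have := @Finset.disjoint_left _ A B
  simp only [Finset.mem_sdiff, mem_outFlow, TensorNetwork.mem_boundary, Finset.mem_univ,
    Finset.mem_union] at he ⊢
  grind

/-- Only the last embedding vertex of `A` is needed: none of its outgoing edges ends in `A`. -/
lemma outEdges_subset_outFlow (hpos : G.IsSketchOrder pos) (hx : x ∈ A ∩ G.embV)
    (hlast : ∀ y ∈ A ∩ G.embV, pos y ≤ pos x) : G.outEdges pos x ⊆ G.outFlow pos A := by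
  obtain ⟨hxA, hxE⟩ := Finset.mem_inter.1 hx
  intro e he
  obtain ⟨he, hxe, h⟩ := Finset.mem_filter.1 he
  refine G.mem_outFlow.2 ⟨he, x, hxe, hxA, h.imp_right ?_⟩
  rintro ⟨y, hy, hxy⟩
  refine ⟨y, hy, fun hyA => ?_, hxy⟩
  by_cases hyE : y ∈ G.embV
  · exact (hlast y (Finset.mem_inter.2 ⟨hyA, hyE⟩)).not_gt hxy
  · exact (hpos.2 y (G.mem_dataV.2 hyE) x hxE).asymm hxy

lemma mem_outFlow_of_disjoint_embV (hpos : G.IsSketchOrder pos) (hA : Disjoint A G.embV)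
    (he : e ∈ G.embE) (hx : x ∈ G.ends e) (hxA : x ∈ A) : e ∈ G.outFlow pos A := by
  obtain ⟨z, hz, hzE⟩ := G.exists_mem_ends_embV he
  exact G.mem_outFlow.2 ⟨he, x, hx, hxA, Or.inr ⟨z, hz, Finset.disjoint_right.1 hA hzE,
    hpos.2 x (G.mem_dataV.2 (Finset.disjoint_left.1 hA hxA)) z hzE⟩⟩

lemma boundary_singleton_disjoint_outFlow [Fintype E] (hpos : G.IsSketchOrder pos)
    (hx : x ∈ G.dataV) (hxB : x ∉ B) :
    Disjoint (G.boundary Finset.univ {x}) (G.outFlow pos B) := by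
  rw [Finset.disjoint_left]
  intro e hxe heB
  replace hxe : x ∈ G.ends e := by
    obtain ⟨-, ⟨x', hx', h⟩, -⟩ := G.mem_boundary.1 hxe
    rwa [← Finset.mem_singleton.1 h]
  obtain ⟨he, y, hy, hyB, h⟩ := G.mem_outFlow.1 heB
  have hxy : x ≠ y := fun h => hxB (h ▸ hyB)
  obtain ⟨z, hz, hzB, hyz⟩ := h.resolve_left (G.notMem_uncontracted he hxe hy hxy)
  obtain ⟨w, hw, hwE⟩ := G.exists_mem_ends_embV he
  obtain rfl : z = x := (G.eq_or_eq_of_mem_ends he hxe hy hxy hz).resolve_right fun h =>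
    hzB (h ▸ hyB)
  obtain rfl : w = y := (G.eq_or_eq_of_mem_ends he hxe hy hxy hw).resolve_left fun h =>
    G.mem_dataV.1 hx (h ▸ hwE)
  exact hyz.asymm (hpos.2 _ hx _ hwE)

lemma effSketchDim_eq_size (pos : V → ℕ) (x : V) :
    (G.effSketchDim pos x : ℝ) = G.size (G.outEdges pos x) := by
  simp [effSketchDim, TensorNetwork.size]

lemma sketchSize_eq_size : (G.sketchSize : ℝ) = G.size G.outputEdges := by
  simp [sketchSize, TensorNetwork.size]

lemma sketchSize_pos : (0 : ℝ) < G.sketchSize := by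
  rw [sketchSize_eq_size]
  exact G.size_pos _

lemma size_outFlow_univ_le (pos : V → ℕ) : G.size (G.outFlow pos Finset.univ) ≤ G.sketchSize := by
  rw [sketchSize_eq_size]
  exact G.size_mono (G.outFlow_univ_subset pos)

lemma effSketchDim_le_size_outFlow (hpos : G.IsSketchOrder pos) (hx : x ∈ A ∩ G.embV)
    (hlast : ∀ y ∈ A ∩ G.embV, pos y ≤ pos x) :
    (G.effSketchDim pos x : ℝ) ≤ G.size (G.outFlow pos A) := by
  rw [effSketchDim_eq_size]
  exact G.size_mono (G.outEdges_subset_outFlow hpos hx hlast)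

lemma effSketchDim_mul_size_outFlow_le (hpos : G.IsSketchOrder pos) (hAB : Disjoint A B)
    (hx : x ∈ A ∩ G.embV) (hlast : ∀ y ∈ (A ∪ B) ∩ G.embV, pos y ≤ pos x) :
    G.effSketchDim pos x * G.size (G.outFlow pos B) ≤
      G.size (G.outFlow pos (A ∪ B)) * G.size (G.outFlow pos B \ G.outFlow pos (A ∪ B)) := by
  have hA : A ∩ G.embV ⊆ (A ∪ B) ∩ G.embV :=
    Finset.inter_subset_inter_right Finset.subset_union_left
  have hdisj : Disjoint (G.outEdges pos x) (G.outFlow pos B) :=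
    (G.outFlow_disjoint pos hAB).mono_left
      (G.outEdges_subset_outFlow hpos hx fun y hy => hlast y (hA hy))
  rw [effSketchDim_eq_size, ← G.size_union hdisj, ← G.size_union Finset.disjoint_sdiff,
    Finset.union_sdiff_self_eq_union]
  exact G.size_mono <|
    Finset.union_subset_union_left (G.outEdges_subset_outFlow hpos (hA hx) hlast)

lemma size_outFlow_mul_size_outFlow_le (hpos : G.IsSketchOrder pos) (hAB : Disjoint A B)
    (hE : Disjoint (A ∪ B) G.embV) :
    G.size (G.outFlow pos A) * G.size (G.outFlow pos B) ≤ G.size (G.outFlow pos (A ∪ B)) := by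
  rw [← G.size_union (G.outFlow_disjoint pos hAB)]
  refine G.size_mono fun e he => ?_
  rcases Finset.mem_union.1 he with he | he <;> obtain ⟨he, y, hy, hyS, -⟩ := G.mem_outFlow.1 he
  · exact G.mem_outFlow_of_disjoint_embV hpos hE he hy (Finset.mem_union_left B hyS)
  · exact G.mem_outFlow_of_disjoint_embV hpos hE he hy (Finset.mem_union_right A hyS)

variable {t : ℝ}

lemma le_sketchSize (hpos : G.IsSketchOrder pos) (hE : G.embV.Nonempty)
    (heff : ∀ x ∈ G.embV, t ≤ G.effSketchDim pos x) : t ≤ G.sketchSize := by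
  obtain ⟨x, hx, hlast⟩ := G.embV.exists_max_image pos hE
  exact (heff x hx).trans <| (G.effSketchDim_le_size_outFlow hpos (by simpa using hx)
    (by simpa using hlast)).trans (G.size_outFlow_univ_le pos)

lemma le_size_outFlow (hpos : G.IsSketchOrder pos) (hunif : G.UniformSketchDims)
    (heff : ∀ x ∈ G.embV, t ≤ G.effSketchDim pos x) (hA : A.Nonempty) :
    t ≤ G.size (G.outFlow pos A) := by
  rcases (A ∩ G.embV).eq_empty_or_nonempty with hAE | hAE
  · replace hAE := Finset.disjoint_iff_inter_eq_empty.2 hAE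
    obtain ⟨x, hx⟩ := hA
    obtain ⟨e, he, hxe⟩ := hunif.1 x (G.mem_dataV.2 (Finset.disjoint_left.1 hAE hx))
    have heE := (Finset.mem_filter.1 he).1
    obtain ⟨z, -, hz⟩ := G.exists_mem_ends_embV heE
    calc t ≤ G.sketchSize := G.le_sketchSize hpos ⟨z, hz⟩ heff
      _ ≤ G.dim e := by exact_mod_cast (hunif.2 e he).le
      _ ≤ _ := G.dim_le_size (G.mem_outFlow_of_disjoint_embV hpos hAE heE hxe hx)
  · obtain ⟨x, hx, hlast⟩ := (A ∩ G.embV).exists_max_image pos hAE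
    exact (heff x (Finset.mem_inter.1 hx).2).trans (G.effSketchDim_le_size_outFlow hpos hx hlast)

lemma sq_le_size_outFlow_mul_size_sdiff (hpos : G.IsSketchOrder pos) (ht : 0 ≤ t)
    (heff : ∀ y ∈ G.embV, t ≤ G.effSketchDim pos y)
    (hflow : ∀ S : Finset V, S.Nonempty → t ≤ G.size (G.outFlow pos S))
    (hAB : Disjoint A B) (hB : B.Nonempty) (hx : x ∈ A ∩ G.embV)
    (hlast : ∀ y ∈ (A ∪ B) ∩ G.embV, pos y ≤ pos x) :
    t ^ 2 ≤
      G.size (G.outFlow pos (A ∪ B)) * G.size (G.outFlow pos B \ G.outFlow pos (A ∪ B)) :=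
  calc t ^ 2 ≤ G.effSketchDim pos x * G.size (G.outFlow pos B) := by
        rw [sq]
        gcongr
        · exact heff x (Finset.mem_inter.1 hx).2
        · exact hflow B hB
    _ ≤ _ := G.effSketchDim_mul_size_outFlow_le hpos hAB hx hlast

lemma embV_nonempty [Nonempty V] (hunif : G.UniformSketchDims) : G.embV.Nonempty := by
  by_contra hE
  obtain ⟨v⟩ := ‹Nonempty V›
  obtain ⟨e, he, -⟩ := hunif.1 v (G.mem_dataV.2 fun hv => hE ⟨v, hv⟩)
  obtain ⟨z, -, hz⟩ := G.exists_mem_ends_embV (Finset.mem_filter.1 he).1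
  exact hE ⟨z, hz⟩

end Flow

section ContractionCost

variable {V : Type u} {E : Type v} [Fintype V] [DecidableEq V] [Fintype E] [DecidableEq E]
  (G : SketchedNetwork V E) {A B X Y : Finset V} {pos : V → ℕ} {F : Finset E}

lemma exp_logCost_dataOnlyEdges_mul_size_le (hAB : Disjoint A B) (hFE : F ⊆ G.embE)
    (hF : F ⊆ G.boundary Finset.univ A ∪ G.boundary Finset.univ B) :
    Real.exp (G.logCost G.dataOnlyEdges A B) * G.size F ≤
      Real.exp (G.logCost Finset.univ A B) := by
  have hR : G.boundary G.dataOnlyEdges A ∪ G.boundary G.dataOnlyEdges B ⊆ G.dataOnlyEdges :=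
    Finset.union_subset (fun _ he => (G.mem_boundary.1 he).1) fun _ he => (G.mem_boundary.1 he).1
  have hdisj : Disjoint (G.boundary G.dataOnlyEdges A ∪ G.boundary G.dataOnlyEdges B) F :=
    (disjoint_compl_left (a := G.embE)).mono hR hFE
  rw [G.exp_logCost _ hAB, G.exp_logCost _ hAB, ← G.size_union hdisj]
  exact G.size_mono <| Finset.union_subset (Finset.union_subset_union
    (G.boundary_mono (Finset.subset_univ _) A) (G.boundary_mono (Finset.subset_univ _) B)) hF

lemma exp_logCost_dataOnlyEdges_mul_outFlow_le (pos : V → ℕ) (hAB : Disjoint A B) :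
    Real.exp (G.logCost G.dataOnlyEdges A B) *
        (G.size (G.outFlow pos A) * G.size (G.outFlow pos B)) ≤
      Real.exp (G.logCost Finset.univ A B) := by
  rw [← G.size_union (G.outFlow_disjoint pos hAB)]
  exact G.exp_logCost_dataOnlyEdges_mul_size_le hAB
    (Finset.union_subset (G.outFlow_subset_embE pos A) (G.outFlow_subset_embE pos B))
    (Finset.union_subset_union (G.outFlow_subset_boundary pos A) (G.outFlow_subset_boundary pos B))

/-- The edges from `B` to `X ∪ Y` are not among the edges leaving `X` or `Y`, but they are legs of
the tensors being contracted. -/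
lemma exp_cut_union_mul_outFlow_le (pos : V → ℕ) (hXY : Disjoint X Y)
    (hB : Disjoint (X ∪ Y) B) :
    Real.exp (G.cut G.dataOnlyEdges (X ∪ Y)) *
        (G.size (G.outFlow pos X) * G.size (G.outFlow pos Y) *
          G.size (G.outFlow pos B \ G.outFlow pos (X ∪ Y ∪ B))) ≤
      Real.exp (G.logCost Finset.univ X Y) := by
  obtain ⟨hXB, hYB⟩ := Finset.disjoint_union_left.1 hB
  have hdisj : Disjoint (G.outFlow pos X ∪ G.outFlow pos Y)
      (G.outFlow pos B \ G.outFlow pos (X ∪ Y ∪ B)) :=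
    Disjoint.mono_right Finset.sdiff_subset <| Finset.disjoint_union_left.2
      ⟨G.outFlow_disjoint pos hXB, G.outFlow_disjoint pos hYB⟩
  rw [← G.size_union (G.outFlow_disjoint pos hXY), ← G.size_union hdisj]
  refine (mul_le_mul_of_nonneg_right (G.exp_cut_union_le_exp_logCost _ hXY)
    (G.size_pos _).le).trans (G.exp_logCost_dataOnlyEdges_mul_size_le hXY ?_ ?_)
  · exact Finset.union_subset (Finset.union_subset (G.outFlow_subset_embE pos X)
      (G.outFlow_subset_embE pos Y)) (Finset.sdiff_subset.trans (G.outFlow_subset_embE pos B))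
  · exact Finset.union_subset (Finset.union_subset_union (G.outFlow_subset_boundary pos X)
      (G.outFlow_subset_boundary pos Y))
      ((G.outFlow_sdiff_outFlow_union_subset_boundary pos hB).trans
        (G.boundary_union_subset _ X Y))

lemma exp_cut_singleton_mul_outFlow_le (hpos : G.IsSketchOrder pos) {x : V} (hx : x ∈ G.dataV)
    (hB : Disjoint {x} B) :
    Real.exp (G.cut Finset.univ {x}) * G.size (G.outFlow pos B) ≤
      Real.exp (G.logCost Finset.univ {x} B) := by
  rw [G.exp_cut, G.exp_logCost _ hB, ← G.size_union (G.boundary_singleton_disjoint_outFlow hpos hx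
    (Finset.disjoint_singleton_left.1 hB))]
  exact G.size_mono (Finset.union_subset_union_right (G.outFlow_subset_boundary pos B))

end ContractionCost

section DataNetwork

variable {V : Type u} {E : Type v} [Fintype V] [DecidableEq V] [Fintype E] [DecidableEq E]
  (G : SketchedNetwork V E)

lemma cut_inter_dataV (A : Finset V) :
    G.cut G.dataOnlyEdges (A ∩ G.dataV) = G.cut G.dataOnlyEdges A := by
  have hboundary : G.boundary G.dataOnlyEdges (A ∩ G.dataV) = G.boundary G.dataOnlyEdges A := by
    ext e
    have := @G.ends_subset_data e
    simp only [TensorNetwork.mem_boundary, dataOnlyEdges, dataV, Finset.mem_compl,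
      Finset.mem_inter, Finset.subset_iff] at this ⊢
    grind
  rw [TensorNetwork.cut, TensorNetwork.cut, hboundary]

lemma cutBetween_inter_dataV (A B : Finset V) :
    G.cutBetween G.dataOnlyEdges (A ∩ G.dataV) (B ∩ G.dataV) =
      G.cutBetween G.dataOnlyEdges A B := by
  refine Finset.sum_congr (Finset.filter_congr fun e he => ?_) fun _ _ => rfl
  have hends : G.ends e ∩ G.dataV = G.ends e :=
    Finset.inter_eq_left.2 (G.ends_subset_data e (Finset.mem_compl.1 he))
  rw [Finset.inter_comm A, Finset.inter_comm B, ← Finset.inter_assoc, ← Finset.inter_assoc, hends]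

lemma sketchTerm_inter_dataV (A B : Finset V) :
    G.sketchTerm (A ∩ G.dataV) (B ∩ G.dataV) = G.sketchTerm A B := by
  simp only [sketchTerm, sizeLeft, sizeShared, sizeContracted, cutBetween_inter_dataV,
    ← Finset.union_inter_distrib_right, cut_inter_dataV]

lemma sizeLeft_pos (A B : Finset V) : 0 < G.sizeLeft A B :=
  Real.exp_pos _

lemma sizeShared_pos (A B : Finset V) : 0 < G.sizeShared A B :=
  div_pos (Real.exp_pos _) (mul_pos (G.sizeLeft_pos _ _) (G.sizeLeft_pos _ _))

lemma sizeContracted_pos (A B : Finset V) : 0 < G.sizeContracted A B :=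
  div_pos (Real.exp_pos _) (G.sizeShared_pos _ _)

lemma sizeShared_comm (A B : Finset V) : G.sizeShared A B = G.sizeShared B A := by
  rw [sizeShared, sizeShared, Finset.union_comm, mul_comm]

lemma sizeContracted_comm (A B : Finset V) : G.sizeContracted A B = G.sizeContracted B A := by
  rw [sizeContracted, sizeContracted, sizeShared_comm, G.cutBetween_comm]

lemma sketchTerm_comm (A B : Finset V) : G.sketchTerm A B = G.sketchTerm B A := by
  simp only [sketchTerm]
  rw [G.sizeShared_comm A B, G.sizeContracted_comm A B, min_comm]
  ring_nf

lemma exp_cut_dataOnlyEdges_union (A B : Finset V) :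
    Real.exp (G.cut G.dataOnlyEdges (A ∪ B)) =
      G.sizeLeft A B * G.sizeLeft B A * G.sizeShared A B := by
  rw [sizeShared, mul_div_cancel₀ _ (mul_pos (G.sizeLeft_pos A B) (G.sizeLeft_pos B A)).ne']

lemma exp_cut_dataOnlyEdges (A B : Finset V) :
    Real.exp (G.cut G.dataOnlyEdges A) =
      G.sizeLeft A B * G.sizeContracted A B * G.sizeShared A B := by
  rw [sizeContracted, mul_assoc, div_mul_cancel₀ _ (G.sizeShared_pos A B).ne', sizeLeft,
    ← Real.exp_add, sub_add_cancel]

lemma exp_logCost_dataOnlyEdges (A B : Finset V) :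
    Real.exp (G.logCost G.dataOnlyEdges A B) =
      G.sizeLeft A B * G.sizeContracted A B * G.sizeLeft B A * G.sizeShared A B := by
  rw [TensorNetwork.logCost, add_sub_assoc, Real.exp_add, G.exp_cut_dataOnlyEdges A B,
    G.cutBetween_comm, ← sizeLeft, mul_right_comm]

end DataNetwork

section TreeCost

variable {V : Type u} {E : Type v} [Fintype V] [DecidableEq V] [Fintype E] [DecidableEq E]
  (G : SketchedNetwork V E) {T T₀ : ContractionTree V} {A B : Finset V} {pos : V → ℕ} {x : V}
  {t K q Y : ℝ}

lemma exp_cut_singleton_mul_le_costAt (hpos : G.IsSketchOrder pos)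
    (hflow : ∀ S : Finset V, S.Nonempty → t ≤ G.size (G.outFlow pos S))
    (hT : T.IsTreeOf Finset.univ) (hE : G.embV.Nonempty) (hx : x ∈ G.dataV) :
    Real.exp (G.cut Finset.univ {x}) * t ≤ T.costAt G.toTensorNetwork G.dataV {x} := by
  obtain ⟨y, hy⟩ := hE
  have hne : ({x} : Finset V) ≠ T.verts := fun h => by
    have hyx : y = x := by rw [← Finset.mem_singleton, h, hT.2]; exact Finset.mem_univ y
    exact G.mem_dataV.1 hx (hyx ▸ hy)
  have hmem : {x} ∈ T.nodes := T.singleton_mem_nodes (hT.2 ▸ Finset.mem_univ x)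
  obtain ⟨B, h⟩ := ContractionTree.exists_contracts_of_mem_nodes hmem hne
  calc Real.exp (G.cut Finset.univ {x}) * t
      ≤ Real.exp (G.cut Finset.univ {x}) * G.size (G.outFlow pos B) := by
        gcongr; exact hflow B h.right_nonempty
    _ ≤ Real.exp (G.logCost Finset.univ {x} B) :=
        G.exp_cut_singleton_mul_outFlow_le hpos hx (h.disjoint hT.1)
    _ ≤ T.costAt G.toTensorNetwork G.dataV ({x} ∩ G.dataV) :=
        h.exp_logCost_le_costAt_left _ _
    _ = T.costAt G.toTensorNetwork G.dataV {x} := by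
        rw [Finset.singleton_inter_of_mem hx]

lemma exp_logCost_dataOnlyEdges_mul_sq_le_costAt (ht : 0 ≤ t)
    (hflow : ∀ S : Finset V, S.Nonempty → t ≤ G.size (G.outFlow pos S))
    (hT : T.leaves.Nodup) (h : T.Contracts A B) :
    Real.exp (G.logCost G.dataOnlyEdges A B) * t ^ 2 ≤
      T.costAt G.toTensorNetwork G.dataV ((A ∪ B) ∩ G.dataV) := by
  calc Real.exp (G.logCost G.dataOnlyEdges A B) * t ^ 2
      ≤ Real.exp (G.logCost G.dataOnlyEdges A B) *
          (G.size (G.outFlow pos A) * G.size (G.outFlow pos B)) := by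
        rw [sq]
        gcongr
        · exact (G.size_pos _).le
        · exact hflow A h.left_nonempty
        · exact hflow B h.right_nonempty
    _ ≤ Real.exp (G.logCost Finset.univ A B) :=
        G.exp_logCost_dataOnlyEdges_mul_outFlow_le pos (h.disjoint hT)
    _ ≤ _ := h.exp_logCost_le_costAt_union _ _

lemma exp_cut_mul_size_outFlow_mul_le_costAt
    (ht : 0 ≤ t) (hflow : ∀ S : Finset V, S.Nonempty → t ≤ G.size (G.outFlow pos S))
    (hT : T.leaves.Nodup) (h : T.Contracts A B) :
    Real.exp (G.cut G.dataOnlyEdges A) * (G.size (G.outFlow pos A) * t) ≤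
      T.costAt G.toTensorNetwork G.dataV (A ∩ G.dataV) := by
  have hflow_pos := G.size_pos (G.outFlow pos A)
  calc Real.exp (G.cut G.dataOnlyEdges A) * (G.size (G.outFlow pos A) * t)
      ≤ Real.exp (G.logCost G.dataOnlyEdges A B) *
          (G.size (G.outFlow pos A) * G.size (G.outFlow pos B)) := by
        refine mul_le_mul (G.exp_cut_le_exp_logCost _ (h.disjoint hT)) ?_ (by positivity)
          (Real.exp_pos _).le
        gcongr
        exact hflow B h.right_nonempty
    _ ≤ Real.exp (G.logCost Finset.univ A B) :=
        G.exp_logCost_dataOnlyEdges_mul_outFlow_le pos (h.disjoint hT)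
    _ ≤ _ := h.exp_logCost_le_costAt_left _ _

lemma exp_cut_union_mul_sketchSize_le_costAt (hK : 1 ≤ K) (ht : 0 ≤ t) (hmt : G.sketchSize ≤ K * t)
    (hflow : ∀ S : Finset V, S.Nonempty → t ≤ G.size (G.outFlow pos S))
    (hT : T.IsTreeOf Finset.univ) (h : T.Contracts A B) :
    Real.exp (G.cut G.dataOnlyEdges (A ∪ B)) * (G.size (G.outFlow pos (A ∪ B)) * G.sketchSize) ≤
      K ^ 2 * T.costAt G.toTensorNetwork G.dataV ((A ∪ B) ∩ G.dataV) := by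
  have hm := G.sketchSize_pos
  have hflow_pos := G.size_pos (G.outFlow pos (A ∪ B))
  by_cases hroot : A ∪ B = Finset.univ
  · have hflow_le : G.size (G.outFlow pos (A ∪ B)) ≤ G.sketchSize := by
      rw [hroot]; exact G.size_outFlow_univ_le pos
    calc Real.exp (G.cut G.dataOnlyEdges (A ∪ B)) *
          (G.size (G.outFlow pos (A ∪ B)) * G.sketchSize)
        ≤ Real.exp (G.logCost G.dataOnlyEdges A B) * (K * t * (K * t)) := by
          exact mul_le_mul (G.exp_cut_union_le_exp_logCost _ (h.disjoint hT.1))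
            (mul_le_mul (hflow_le.trans hmt) hmt hm.le (hm.le.trans hmt)) (by positivity)
            (Real.exp_pos _).le
      _ = K ^ 2 * (Real.exp (G.logCost G.dataOnlyEdges A B) * t ^ 2) := by ring
      _ ≤ _ := by
          gcongr
          exact G.exp_logCost_dataOnlyEdges_mul_sq_le_costAt ht hflow hT.1 h
  · obtain ⟨P, hP⟩ := ContractionTree.exists_contracts_of_mem_nodes h.union_mem_nodes
      (hT.2.symm ▸ hroot)
    calc Real.exp (G.cut G.dataOnlyEdges (A ∪ B)) *
          (G.size (G.outFlow pos (A ∪ B)) * G.sketchSize)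
        ≤ Real.exp (G.cut G.dataOnlyEdges (A ∪ B)) *
            (G.size (G.outFlow pos (A ∪ B)) * (K * t)) := by gcongr
      _ = K * (Real.exp (G.cut G.dataOnlyEdges (A ∪ B)) *
            (G.size (G.outFlow pos (A ∪ B)) * t)) := by ring
      _ ≤ K ^ 2 * T.costAt G.toTensorNetwork G.dataV ((A ∪ B) ∩ G.dataV) := by
          gcongr
          · exact le_self_pow₀ hK two_ne_zero
          · exact G.exp_cut_mul_size_outFlow_mul_le_costAt ht hflow hT.1 hP

lemma exp_cut_mul_size_sdiff_mul_sq_le_costAt (ht : 0 ≤ t)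
    (hflow : ∀ S : Finset V, S.Nonempty → t ≤ G.size (G.outFlow pos S))
    (hT : T.leaves.Nodup) (h : T.Contracts A B) (hA : (A ∩ G.dataV).Nonempty)
    (hx : x ∈ A ∩ G.embV) :
    Real.exp (G.cut G.dataOnlyEdges A) *
        (G.size (G.outFlow pos B \ G.outFlow pos (A ∪ B)) * t ^ 2) ≤
      T.costAt G.toTensorNetwork G.dataV (A ∩ G.dataV) := by
  obtain ⟨y, rfl⟩ | ⟨X, Y, hXY, rfl⟩ :=
    ContractionTree.eq_singleton_or_eq_union_of_mem_nodes h.left_mem_nodes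
  · obtain ⟨z, hz⟩ := hA
    simp only [Finset.mem_inter, Finset.mem_singleton, mem_dataV] at hx hz
    exact absurd (hx.1 ▸ hx.2) (hz.1 ▸ hz.2)
  · have hflow_XY : t ^ 2 ≤ G.size (G.outFlow pos X) * G.size (G.outFlow pos Y) := by
      rw [sq]
      exact mul_le_mul (hflow X hXY.left_nonempty) (hflow Y hXY.right_nonempty) ht
        (G.size_pos _).le
    have hback_pos := G.size_pos (G.outFlow pos B \ G.outFlow pos (X ∪ Y ∪ B))
    calc Real.exp (G.cut G.dataOnlyEdges (X ∪ Y)) *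
          (G.size (G.outFlow pos B \ G.outFlow pos (X ∪ Y ∪ B)) * t ^ 2)
        ≤ Real.exp (G.cut G.dataOnlyEdges (X ∪ Y)) *
            (G.size (G.outFlow pos X) * G.size (G.outFlow pos Y) *
              G.size (G.outFlow pos B \ G.outFlow pos (X ∪ Y ∪ B))) := by
          rw [mul_comm (G.size _)]
          gcongr
      _ ≤ Real.exp (G.logCost Finset.univ X Y) :=
          G.exp_cut_union_mul_outFlow_le pos (hXY.disjoint hT) (h.disjoint hT)
      _ ≤ _ := hXY.exp_logCost_le_costAt_union _ _

lemma sketchTerm_le_of_sq_le (hK : 1 ≤ K) (ht : 0 ≤ t) (hmt : G.sketchSize ≤ K * t)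
    (hflow : ∀ S : Finset V, S.Nonempty → t ≤ G.size (G.outFlow pos S))
    (hT : T.IsTreeOf Finset.univ) (h : T.Contracts A B) (hq : 0 ≤ q)
    (hsq : t ^ 2 ≤ G.size (G.outFlow pos (A ∪ B)) * q)
    (hY : Real.exp (G.cut G.dataOnlyEdges A) * (q * t ^ 2) ≤ Y) :
    G.sketchTerm A B ≤
      K ^ 3 * (2 * T.costAt G.toTensorNetwork G.dataV ((A ∪ B) ∩ G.dataV) + Y) := by
  have hX := G.exp_cut_union_mul_sketchSize_le_costAt hK ht hmt hflow hT h
  have hdense := G.exp_logCost_dataOnlyEdges_mul_sq_le_costAt ht hflow hT.1 h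
  rw [exp_cut_dataOnlyEdges_union] at hX
  rw [G.exp_cut_dataOnlyEdges A B] at hY
  rw [exp_logCost_dataOnlyEdges] at hdense
  have ha := G.sizeLeft_pos A B
  have hb := G.sizeContracted_pos A B
  have hc := G.sizeLeft_pos B A
  have hd := G.sizeShared_pos A B
  have hm := G.sketchSize_pos
  have hX₀ := T.costAt_nonneg G.toTensorNetwork G.dataV ((A ∪ B) ∩ G.dataV)
  simp only [sketchTerm]
  generalize G.sizeLeft A B = a, G.sizeContracted A B = b, G.sizeLeft B A = c,
    G.sizeShared A B = d, (G.sketchSize : ℝ) = m,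
    T.costAt G.toTensorNetwork G.dataV ((A ∪ B) ∩ G.dataV) = X at *
  have hdense' : a * b * c * d * m ^ 2 ≤ K ^ 3 * X :=
    calc a * b * c * d * m ^ 2 ≤ a * b * c * d * (K * t) ^ 2 := by gcongr
      _ = K ^ 2 * (a * b * c * d * t ^ 2) := by ring
      _ ≤ K ^ 3 * X := by
        gcongr
        norm_num
  have hsqrt : m ^ 2 * d * √(a * b * c * m) * min √a √c ≤ K ^ 3 * (X + Y) :=
    calc m ^ 2 * d * √(a * b * c * m) * min √a √c ≤ m ^ 2 * d * √(a * b * c * m) * √a := by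
          gcongr
          exact min_le_left _ _
      _ ≤ K ^ 3 * (X + Y) := sq_mul_sqrt_mul_sqrt_le ha.le hb.le hc.le hd.le hm.le
          (zero_le_one.trans hK) hq hX₀ hmt hX hY hsq
  linarith

lemma sketchTerm_le_of_mem_left (hpos : G.IsSketchOrder pos) (hK : 1 ≤ K) (ht : 0 ≤ t)
    (hmt : G.sketchSize ≤ K * t) (heff : ∀ y ∈ G.embV, t ≤ G.effSketchDim pos y)
    (hflow : ∀ S : Finset V, S.Nonempty → t ≤ G.size (G.outFlow pos S))
    (hT : T.IsTreeOf Finset.univ) (h : T.Contracts A B) (hA : (A ∩ G.dataV).Nonempty)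
    (hx : x ∈ A ∩ G.embV) (hlast : ∀ y ∈ (A ∪ B) ∩ G.embV, pos y ≤ pos x) :
    G.sketchTerm A B ≤
      K ^ 3 * (2 * T.costAt G.toTensorNetwork G.dataV ((A ∪ B) ∩ G.dataV) +
        T.costAt G.toTensorNetwork G.dataV (A ∩ G.dataV)) :=
  G.sketchTerm_le_of_sq_le hK ht hmt hflow hT h (G.size_pos _).le
    (G.sq_le_size_outFlow_mul_size_sdiff hpos ht heff hflow (h.disjoint hT.1) h.right_nonempty
      hx hlast)
    (G.exp_cut_mul_size_sdiff_mul_sq_le_costAt ht hflow hT.1 h hA hx)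

lemma sketchTerm_le_of_disjoint_embV (hpos : G.IsSketchOrder pos) (hK : 1 ≤ K) (ht : 0 ≤ t)
    (hmt : G.sketchSize ≤ K * t)
    (hflow : ∀ S : Finset V, S.Nonempty → t ≤ G.size (G.outFlow pos S))
    (hT : T.IsTreeOf Finset.univ) (h : T.Contracts A B) (hE : Disjoint (A ∪ B) G.embV) :
    G.sketchTerm A B ≤
      K ^ 3 * (3 * T.costAt G.toTensorNetwork G.dataV ((A ∪ B) ∩ G.dataV)) := by
  have hAB := h.disjoint hT.1
  have hsq : t ^ 2 ≤ G.size (G.outFlow pos (A ∪ B)) * 1 := by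
    rw [sq, mul_one]
    exact (mul_le_mul (hflow A h.left_nonempty) (hflow B h.right_nonempty) ht
      (G.size_pos _).le).trans (G.size_outFlow_mul_size_outFlow_le hpos hAB hE)
  have hY : Real.exp (G.cut G.dataOnlyEdges A) * (1 * t ^ 2) ≤
      T.costAt G.toTensorNetwork G.dataV ((A ∪ B) ∩ G.dataV) := by
    rw [one_mul]
    exact (mul_le_mul_of_nonneg_right (G.exp_cut_le_exp_logCost _ hAB) (sq_nonneg t)).trans
      (G.exp_logCost_dataOnlyEdges_mul_sq_le_costAt ht hflow hT.1 h)
  exact (G.sketchTerm_le_of_sq_le hK ht hmt hflow hT h zero_le_one hsq hY).trans_eq (by ring)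

lemma sketchTerm_le (hpos : G.IsSketchOrder pos) (hK : 1 ≤ K) (ht : 0 ≤ t)
    (hmt : G.sketchSize ≤ K * t) (heff : ∀ y ∈ G.embV, t ≤ G.effSketchDim pos y)
    (hflow : ∀ S : Finset V, S.Nonempty → t ≤ G.size (G.outFlow pos S))
    (hT : T.IsTreeOf Finset.univ) (h : T.Contracts A B) (hA : (A ∩ G.dataV).Nonempty)
    (hB : (B ∩ G.dataV).Nonempty) :
    G.sketchTerm A B ≤
      K ^ 3 * (3 * T.costAt G.toTensorNetwork G.dataV ((A ∪ B) ∩ G.dataV) +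
        (T.costAt G.toTensorNetwork G.dataV (A ∩ G.dataV) +
          T.costAt G.toTensorNetwork G.dataV (B ∩ G.dataV))) := by
  have hNA := T.costAt_nonneg G.toTensorNetwork G.dataV (A ∩ G.dataV)
  have hNB := T.costAt_nonneg G.toTensorNetwork G.dataV (B ∩ G.dataV)
  have hNAB := T.costAt_nonneg G.toTensorNetwork G.dataV ((A ∪ B) ∩ G.dataV)
  rcases ((A ∪ B) ∩ G.embV).eq_empty_or_nonempty with hE | hE
  · refine (G.sketchTerm_le_of_disjoint_embV hpos hK ht hmt hflow hT h
      (Finset.disjoint_iff_inter_eq_empty.2 hE)).trans ?_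
    gcongr
    linarith
  obtain ⟨x, hx, hlast⟩ := ((A ∪ B) ∩ G.embV).exists_max_image pos hE
  rw [Finset.union_inter_distrib_right, Finset.mem_union] at hx
  rcases hx with hx | hx
  · refine (G.sketchTerm_le_of_mem_left hpos hK ht hmt heff hflow hT h hA hx hlast).trans ?_
    gcongr ?_ * ?_
    linarith
  · rw [Finset.union_comm] at hlast
    rw [sketchTerm_comm]
    refine (G.sketchTerm_le_of_mem_left hpos hK ht hmt heff hflow hT h.symm hB hx hlast).trans ?_
    rw [Finset.union_comm B A]
    gcongr ?_ * ?_
    linarith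

lemma sum_exp_cut_add_sum_sketchTerm_le (hpos : G.IsSketchOrder pos) (hK : 1 ≤ K) (ht : 0 ≤ t)
    (hmt : G.sketchSize ≤ K * t) (heff : ∀ y ∈ G.embV, t ≤ G.effSketchDim pos y)
    (hflow : ∀ S : Finset V, S.Nonempty → t ≤ G.size (G.outFlow pos S)) (hE : G.embV.Nonempty)
    (hT₀ : T₀.IsTreeOf G.dataV) (hT : T.IsTreeOf Finset.univ) (hcon : T.ConstrainedOn T₀ G.dataV) :
    ∑ x ∈ G.dataV, Real.exp (G.cut Finset.univ {x}) * G.sketchSize +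
        (T₀.contractions.map fun p => G.sketchTerm p.1 p.2).sum ≤
      12 * K ^ 3 * T.cost G.toTensorNetwork := by
  set N := T.costAt G.toTensorNetwork G.dataV
  have hN : ∀ S, 0 ≤ N S := T.costAt_nonneg _ _
  have hleaf : ∀ x ∈ G.dataV,
      Real.exp (G.cut Finset.univ {x}) * G.sketchSize ≤ K ^ 3 * N {x} := fun x hx =>
    calc Real.exp (G.cut Finset.univ {x}) * G.sketchSize
        ≤ Real.exp (G.cut Finset.univ {x}) * (K * t) := by gcongr
      _ = K * (Real.exp (G.cut Finset.univ {x}) * t) := by ring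
      _ ≤ K ^ 3 * N {x} := by
        gcongr
        · exact le_self_pow₀ hK three_ne_zero
        · exact G.exp_cut_singleton_mul_le_costAt hpos hflow hT hE hx
  have hcontr : ∀ p ∈ T₀.contractions,
      G.sketchTerm p.1 p.2 ≤ K ^ 3 * (3 * N (p.1 ∪ p.2) + (N p.1 + N p.2)) := fun p hp => by
    have hp : T₀.Contracts p.1 p.2 := Or.inl hp
    obtain ⟨A, B, h, hA, hB⟩ := hcon _ _ hp
    have := G.sketchTerm_le hpos hK ht hmt heff hflow hT h (hA ▸ hp.left_nonempty)
      (hB ▸ hp.right_nonempty)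
    rwa [← sketchTerm_inter_dataV, Finset.union_inter_distrib_right, hA, hB] at this
  calc _ ≤ ∑ x ∈ G.dataV, K ^ 3 * N {x} +
          (T₀.contractions.map fun p => K ^ 3 * (3 * N (p.1 ∪ p.2) + (N p.1 + N p.2))).sum :=
        add_le_add (Finset.sum_le_sum hleaf) (List.sum_le_sum hcontr)
    _ = K ^ 3 * ((T₀.leaves.map fun x => N {x}).sum +
          (T₀.contractions.map fun p => 3 * N (p.1 ∪ p.2) + (N p.1 + N p.2)).sum) := by
        rw [List.sum_map_mul_left, ← Finset.mul_sum, ← mul_add, ← hT₀.2,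
          ContractionTree.verts, List.sum_toFinset _ hT₀.1]
    _ ≤ K ^ 3 * (4 * (3 * T.cost G.toTensorNetwork)) := by
        gcongr
        refine (T₀.sum_leaves_add_sum_contractions_le hN).trans ?_
        rw [← List.sum_toFinset _ (ContractionTree.nodup_nodes hT₀.1)]
        gcongr
        exact T.sum_costAt_le _ _ _
    _ = 12 * K ^ 3 * T.cost G.toTensorNetwork := by ring

end TreeCost

end SketchedNetwork

theorem theoremE1_general {V : Type u} {E : Type v} [Fintype V] [DecidableEq V] [Fintype E]
    [DecidableEq E] {G : SketchedNetwork V E} {T₀ T : ContractionTree V} {pos : V → ℕ} {c C s : ℝ}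
    (hc : 0 < c) (hC : 0 < C) (hunif : G.UniformSketchDims) (hpos : G.IsSketchOrder pos)
    (heff : ∀ x ∈ G.embV, c * s ≤ G.effSketchDim pos x) (hm : G.sketchSize ≤ C * s)
    (hT₀ : T₀.IsTreeOf G.dataV) (hT : T.IsTreeOf Finset.univ)
    (hcon : T.ConstrainedOn T₀ G.dataV) :
    c * s ≤ G.sketchSize ∧
      (c / C) ^ 3 / 12 * ((∑ x ∈ G.dataV, Real.exp (G.cut Finset.univ {x}) * G.sketchSize)
          + (T₀.contractions.map fun p => G.sketchTerm p.1 p.2).sum)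
        ≤ T.cost G.toTensorNetwork := by
  have hV : Nonempty V := T.verts_nonempty.to_type
  have hE := G.embV_nonempty hunif
  have hs : 0 < s := pos_of_mul_pos_right (G.sketchSize_pos.trans_le hm) hC.le
  have hcs : c * s ≤ G.sketchSize := G.le_sketchSize hpos hE heff
  have hK : 1 ≤ C / c := (one_le_div hc).2 (le_of_mul_le_mul_right (hcs.trans hm) hs)
  have hmt : G.sketchSize ≤ C / c * (c * s) := by rwa [← mul_assoc, div_mul_cancel₀ _ hc.ne']
  have hsum := G.sum_exp_cut_add_sum_sketchTerm_le hpos hK (by positivity) hmt heff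
    (fun _ => G.le_size_outFlow hpos hunif heff) hE hT₀ hT hcon
  refine ⟨hcs, (mul_le_mul_of_nonneg_left hsum (by positivity)).trans_eq ?_⟩
  field_simp

theorem theoremE1 (c C : ℝ) (hc : 0 < c) (hC : 0 < C) :
    ∃ κ : ℝ, 0 < κ ∧
      ∀ (V : Type u) (E : Type v) [Fintype V] [DecidableEq V] [Fintype E] [DecidableEq E]
        (G : SketchedNetwork V E) (ε δ : ℝ) (T₀ T : ContractionTree V),
        0 < ε → 0 < δ → δ < 1 →
        G.UniformSketchDims →
        G.SufficientCondition c ε δ →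
        G.outputEdges.card = 1 →
        (G.sketchSize : ℝ) ≤ C * G.accuracyScale ε δ →
        T₀.IsTreeOf G.dataV →
        T.IsTreeOf Finset.univ →
        T.ConstrainedOn T₀ G.dataV →
        c * G.accuracyScale ε δ ≤ (G.sketchSize : ℝ) ∧
        κ * ((∑ x ∈ G.dataV, Real.exp (G.cut Finset.univ {x}) * (G.sketchSize : ℝ))
            + (T₀.contractions.map fun p => G.sketchTerm p.1 p.2).sum)
          ≤ T.cost G.toTensorNetwork := by
  refine ⟨(c / C) ^ 3 / 12, by positivity, ?_⟩
  intro V E _ _ _ _ G ε δ T₀ T _ _ _ hunif ⟨pos, hpos, heff⟩ _ hm hT₀ hT hcon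
  exact theoremE1_general hc hC hunif hpos heff hm hT₀ hT hcon
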